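/- Let $\mathbb{A}_0=(0,1]\times\{0\}$, $\mathbb{A}_1=[0,1)\times\{1\}$, and let $\mathbb{A}=\mathbb{A}_0\cup\mathbb{A}_1$ be the Alexandroff--Urysohn double arrow space, that is, $\mathbb{A}$ is ordered lexicographically ($\langle x,t\rangle<\langle y,s\rangle$ iff $x<y$, or $x=y$ and $t<s$) and carries the order topology of this order. For a separable topological space $X$ and a cardinal $\kappa$, say that $X$ has $\kappa$ types of countable dense subsets if $\kappa$ is the minimum cardinal for which there is a collection $\mathcal{D}$ of countable dense subsets of $X$ with $|\mathcal{D}|=\kappa$ such that for every countable dense subset $E\subset X$ there are $D\in\mathcal{D}$ and a homeomorphism $h:X\to X$ with $h[D]=E$. Theorem. $\mathbb{A}$ has $\mathfrak{c}$ types of countable dense subsets, where $\mathfrak{c}=2^{\aleph_0}$ is the cardinality of the continuum. -/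

import Mathlib

/-- The set `𝔸₀ = (0, 1] × {0}`, inside `ℝ × {0, 1}` with the lexicographic order. -/
def doubleArrowZero : Set (ℝ ×ₗ Fin 2) :=
  {p | (ofLex p).1 ∈ Set.Ioc (0 : ℝ) 1 ∧ (ofLex p).2 = 0}

/-- The set `𝔸₁ = [0, 1) × {1}`, inside `ℝ × {0, 1}` with the lexicographic order. -/
def doubleArrowOne : Set (ℝ ×ₗ Fin 2) :=
  {p | (ofLex p).1 ∈ Set.Ico (0 : ℝ) 1 ∧ (ofLex p).2 = 1}

/-- The underlying set `𝔸 = 𝔸₀ ∪ 𝔸₁` of the Alexandroff-Urysohn double arrow space. -/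
def DoubleArrow : Type :=
  {p : ℝ ×ₗ Fin 2 // p ∈ doubleArrowZero ∪ doubleArrowOne}

namespace DoubleArrow

/-- The lexicographic order on `𝔸`. -/
noncomputable instance instLinearOrderDoubleArrow : LinearOrder DoubleArrow :=
  inferInstanceAs (LinearOrder {p : ℝ ×ₗ Fin 2 // p ∈ doubleArrowZero ∪ doubleArrowOne})

/-- The topology of `𝔸` is the order topology of the linear order of `𝔸` itself,
generated by the open rays of `𝔸`. -/
noncomputable instance instTopologicalSpaceDoubleArrow : TopologicalSpace DoubleArrow :=
  Preorder.topology DoubleArrow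

instance instOrderTopologyDoubleArrow : OrderTopology DoubleArrow := ⟨rfl⟩

theorem lt_iff (p q : DoubleArrow) :
    p < q ↔ (ofLex p.1).1 < (ofLex q.1).1 ∨
      (ofLex p.1).1 = (ofLex q.1).1 ∧ (ofLex p.1).2 < (ofLex q.1).2 :=
  Prod.Lex.lt_iff

end DoubleArrow

/-- `𝒟` is a family of countable dense subsets of `X` such that every countable dense subset
of `X` is the image of a member of `𝒟` under an autohomeomorphism of `X`. -/
def RepresentsCountableDenseSubsets {X : Type*} [TopologicalSpace X] (𝒟 : Set (Set X)) : Prop :=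
  (∀ D ∈ 𝒟, D.Countable ∧ Dense D) ∧
    ∀ E : Set X, E.Countable → Dense E → ∃ D ∈ 𝒟, ∃ h : X ≃ₜ X, h '' D = E

/-- `X` has `κ` types of countable dense subsets: `κ` is the minimum cardinality of a family of
countable dense subsets of `X` that represents all of them up to autohomeomorphism of `X`. -/
def HasTypesOfCountableDenseSubsets (X : Type*) [TopologicalSpace X] (κ : Cardinal) : Prop :=
  IsLeast {c : Cardinal | ∃ 𝒟 : Set (Set X),
    RepresentsCountableDenseSubsets 𝒟 ∧ Cardinal.mk 𝒟 = c} κ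

/-!
There are only `𝔠` countable subsets of `𝔸`, so the family of all countable dense subsets has at
most `𝔠` members. For the lower bound, sets `S` of natural numbers are coded by countable dense sets
`codeSet e S` such that no homeomorphism carries one code to another.

Call the two points of `𝔸` over some `x ∈ (0, 1)` twins. A homeomorphism of `𝔸` need not preserve
twins, but every nonempty open set contains a nonempty open set on which it is monotone or antitone
(`exists_monotoneOn_or_antitoneOn`). This holds because `Iic p` or `Ici p` is open for every `p`, so
that near a point a continuous map stays, on the left of that point, on one side of the value there;
Baire's theorem makes this uniform on a dense subset of an interval. Hence the largest open set in
which the full fibres of `D` are dense, `twinRegion D`, is natural under homeomorphisms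
(`image_twinRegion`), and so are its frontier and the iterated derived sets of the frontier.

The ordinals up to `ω ^ ω` are embedded in `[0, 1]` by a continuous increasing map. The code of `S`
has full fibres in the lower halves of the gaps of the image and no full fibres in the upper halves.
Then the frontier of the twin region consists of the points `⟨x, 0⟩` over limit ordinals, whatever
`S` is, and its `n`th derived set consists of those over multiples of `ω ^ (n + 1)`
(`derivedSet_multiplesSet`). The code contains a point of the `n`th derived set outside the next one
exactly if `n ∈ S`, so `S` can be recovered from the code up to homeomorphism
(`eq_of_image_codeSet_eq`).
-/

open Set Filter Topology

namespace DoubleArrow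

/-! ### Cells: the clopen intervals of the double arrow space -/

/-- The projection of `𝔸` to the unit interval. -/
def fst (p : DoubleArrow) : ℝ := (ofLex p.1).1

/-- The side of a point of `𝔸`: `0` on `𝔸₀`, `1` on `𝔸₁`. -/
def snd (p : DoubleArrow) : Fin 2 := (ofLex p.1).2

/-- The point `⟨x, 0⟩` of `𝔸`. -/
def left (x : ℝ) (hx : x ∈ Ioc (0 : ℝ) 1) : DoubleArrow := ⟨toLex (x, 0), Or.inl ⟨hx, rfl⟩⟩

/-- The point `⟨x, 1⟩` of `𝔸`. -/
def right (x : ℝ) (hx : x ∈ Ico (0 : ℝ) 1) : DoubleArrow := ⟨toLex (x, 1), Or.inr ⟨hx, rfl⟩⟩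

@[simp] theorem fst_left {x : ℝ} (hx) : (left x hx).fst = x := rfl
@[simp] theorem snd_left {x : ℝ} (hx) : (left x hx).snd = 0 := rfl
@[simp] theorem fst_right {x : ℝ} (hx) : (right x hx).fst = x := rfl
@[simp] theorem snd_right {x : ℝ} (hx) : (right x hx).snd = 1 := rfl

theorem mem_sides (p : DoubleArrow) :
    (p.fst ∈ Ioc (0 : ℝ) 1 ∧ p.snd = 0) ∨ (p.fst ∈ Ico (0 : ℝ) 1 ∧ p.snd = 1) := p.2

theorem ext_coords {p q : DoubleArrow} (h₁ : p.fst = q.fst) (h₂ : p.snd = q.snd) : p = q :=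
  Subtype.ext (Prod.ext h₁ h₂ : ofLex p.1 = ofLex q.1)

theorem lt_coords {p q : DoubleArrow} :
    p < q ↔ p.fst < q.fst ∨ p.fst = q.fst ∧ p.snd = 0 ∧ q.snd = 1 := by
  rw [lt_iff]
  change p.fst < q.fst ∨ p.fst = q.fst ∧ p.snd < q.snd ↔ _
  rcases mem_sides p with ⟨-, hp⟩ | ⟨-, hp⟩ <;> rcases mem_sides q with ⟨-, hq⟩ | ⟨-, hq⟩ <;>
    simp [hp, hq]

/-- The clopen interval of `𝔸` from `⟨a, 1⟩` to `⟨b, 0⟩`, both included. The description by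
coordinates makes sense for all real `a` and `b`. -/
def cell (a b : ℝ) : Set DoubleArrow :=
  {p | (a < p.fst ∨ a = p.fst ∧ p.snd = 1) ∧ (p.fst < b ∨ p.fst = b ∧ p.snd = 0)}

theorem fst_mem_of_mem_cell {a b : ℝ} {p : DoubleArrow} (h : p ∈ cell a b) :
    p.fst ∈ Icc a b := by
  obtain ⟨h₁ | ⟨h₁, -⟩, h₂ | ⟨h₂, -⟩⟩ := h <;> constructor <;> linarith

theorem mem_cell_of_fst_mem {a b : ℝ} {p : DoubleArrow} (h : p.fst ∈ Ioo a b) : p ∈ cell a b :=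
  ⟨Or.inl h.1, Or.inl h.2⟩

theorem cell_mono {a b c d : ℝ} (h₁ : c ≤ a) (h₂ : b ≤ d) : cell a b ⊆ cell c d := by
  rintro p ⟨ha, hb⟩
  constructor
  · rcases ha with ha | ha
    · exact Or.inl (h₁.trans_lt ha)
    · rcases h₁.lt_or_eq with h | h
      · exact Or.inl (ha.1 ▸ h)
      · exact Or.inr ⟨h.trans ha.1, ha.2⟩
  · rcases hb with hb | hb
    · exact Or.inl (hb.trans_le h₂)
    · rcases h₂.lt_or_eq with h | h
      · exact Or.inl (hb.1 ▸ h)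
      · exact Or.inr ⟨hb.1.trans h, hb.2⟩

theorem isOpen_gt_right (a : ℝ) :
    IsOpen {p : DoubleArrow | a < p.fst ∨ a = p.fst ∧ p.snd = 1} := by
  rcases le_or_gt a 0 with h | h
  · convert isOpen_univ
    ext p
    simp only [mem_ofPred_eq, mem_univ, iff_true]
    rcases mem_sides p with ⟨hp, h1⟩ | ⟨hp, h1⟩
    · exact Or.inl (h.trans_lt hp.1)
    · rcases (h.trans hp.1).lt_or_eq with h2 | h2
      · exact Or.inl h2
      · exact Or.inr ⟨h2, h1⟩
  rcases le_or_gt a 1 with h' | h'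
  · have ha : a ∈ Ioc (0 : ℝ) 1 := ⟨h, h'⟩
    convert isOpen_Ioi (a := left a ha)
    ext p
    rw [mem_ofPred_eq, mem_Ioi, lt_coords, fst_left, snd_left]
    simp
  · convert isOpen_empty
    ext p
    simp only [mem_ofPred_eq, mem_empty_iff_false, iff_false]
    rcases mem_sides p with ⟨hp, h1⟩ | ⟨hp, h1⟩ <;> rintro (h2 | ⟨h2, -⟩) <;>
      linarith [hp.2]

theorem isOpen_lt_left (b : ℝ) :
    IsOpen {p : DoubleArrow | p.fst < b ∨ p.fst = b ∧ p.snd = 0} := by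
  rcases le_or_gt 1 b with h | h
  · convert isOpen_univ
    ext p
    simp only [mem_ofPred_eq, mem_univ, iff_true]
    rcases mem_sides p with ⟨hp, h1⟩ | ⟨hp, h1⟩
    · rcases (hp.2.trans h).lt_or_eq with h2 | h2
      · exact Or.inl h2
      · exact Or.inr ⟨h2, h1⟩
    · exact Or.inl (hp.2.trans_le h)
  rcases le_or_gt 0 b with h' | h'
  · have hb : b ∈ Ico (0 : ℝ) 1 := ⟨h', h⟩
    convert isOpen_Iio (a := right b hb)
    ext p
    rw [mem_ofPred_eq, mem_Iio, lt_coords, fst_right, snd_right]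
    simp
  · convert isOpen_empty
    ext p
    simp only [mem_ofPred_eq, mem_empty_iff_false, iff_false]
    rcases mem_sides p with ⟨hp, h1⟩ | ⟨hp, h1⟩ <;> rintro (h2 | ⟨h2, -⟩) <;>
      linarith [hp.1]

theorem isOpen_cell (a b : ℝ) : IsOpen (cell a b) := (isOpen_gt_right a).inter (isOpen_lt_left b)

theorem ordConnected_cell (a b : ℝ) : (cell a b).OrdConnected := by
  refine ⟨fun p hp q hq z hz => ⟨?_, ?_⟩⟩
  · rcases hz.1.eq_or_lt with rfl | h
    · exact hp.1
    · rcases lt_coords.1 h with h | ⟨h, -, h'⟩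
      · exact Or.inl ((fst_mem_of_mem_cell hp).1.trans_lt h)
      · rcases hp.1 with h1 | h1
        · exact Or.inl (h ▸ h1)
        · exact Or.inr ⟨h1.1.trans h, h'⟩
  · rcases hz.2.eq_or_lt with rfl | h
    · exact hq.2
    · rcases lt_coords.1 h with h | ⟨h, h', -⟩
      · exact Or.inl (h.trans_le (fst_mem_of_mem_cell hq).2)
      · rcases hq.2 with h1 | h1
        · exact Or.inl (h ▸ h1)
        · exact Or.inr ⟨h.trans h1.1, h'⟩

theorem right_mem_cell {x b : ℝ} (hx : x ∈ Ico (0 : ℝ) 1) (h : x < b) : right x hx ∈ cell x b :=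
  ⟨Or.inr ⟨rfl, rfl⟩, Or.inl h⟩

/-- A point of `𝔸₀` has a neighbourhood basis of cells that end at it. -/
theorem exists_cell_subset_of_left {p : DoubleArrow} (hp : p.snd = 0) {U : Set DoubleArrow}
    (hU : U ∈ 𝓝 p) : ∃ a, 0 ≤ a ∧ a < p.fst ∧ cell a p.fst ⊆ U := by
  have hp' : p.fst ∈ Ioc (0 : ℝ) 1 := by
    rcases mem_sides p with h | h
    · exact h.1
    · simp [hp] at h
  obtain ⟨l, hl, hlU⟩ := exists_Ioc_subset_of_mem_nhds hU
    ⟨right 0 ⟨le_rfl, one_pos⟩, lt_coords.2 (Or.inl hp'.1)⟩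
  have hl' : l.fst < p.fst := by
    rcases lt_coords.1 hl with h | h
    · exact h
    · simp [hp] at h
  have h0 : 0 ≤ l.fst := by
    rcases mem_sides l with h | h
    exacts [h.1.1.le, h.1.1]
  refine ⟨(l.fst + p.fst) / 2, by linarith [hp'.1], by linarith, fun q hq => hlU ⟨?_, ?_⟩⟩
  · exact lt_coords.2 (Or.inl (by linarith [(fst_mem_of_mem_cell hq).1]))
  · refine le_of_not_gt fun h => ?_
    rcases lt_coords.1 h with h | h
    · exact absurd (fst_mem_of_mem_cell hq).2 (not_le.2 h)
    · rcases hq.2 with h' | h'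
      · exact h'.ne' h.1
      · simp [h'.2] at h

/-- A point of `𝔸₁` has a neighbourhood basis of cells that start at it. -/
theorem exists_cell_subset_of_right {p : DoubleArrow} (hp : p.snd = 1) {U : Set DoubleArrow}
    (hU : U ∈ 𝓝 p) : ∃ b, b ≤ 1 ∧ p.fst < b ∧ cell p.fst b ⊆ U := by
  have hp' : p.fst ∈ Ico (0 : ℝ) 1 := by
    rcases mem_sides p with h | h
    · simp [hp] at h
    · exact h.1
  obtain ⟨l, hl, hlU⟩ := exists_Ico_subset_of_mem_nhds hU
    ⟨left 1 ⟨one_pos, le_rfl⟩, lt_coords.2 (Or.inl hp'.2)⟩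
  have hl' : p.fst < l.fst := by
    rcases lt_coords.1 hl with h | h
    · exact h
    · simp [hp] at h
  have h0 : l.fst ≤ 1 := by
    rcases mem_sides l with h | h
    exacts [h.1.2, h.1.2.le]
  refine ⟨(p.fst + l.fst) / 2, by linarith [hp'.2], by linarith, fun q hq => hlU ⟨?_, ?_⟩⟩
  · refine le_of_not_gt fun h => ?_
    rcases lt_coords.1 h with h | h
    · exact absurd (fst_mem_of_mem_cell hq).1 (not_le.2 h)
    · rcases hq.1 with h' | h'
      · exact h'.ne' h.1
      · simp [h'.2] at h
  · exact lt_coords.2 (Or.inl (by linarith [(fst_mem_of_mem_cell hq).2]))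

theorem exists_cell_subset {W : Set DoubleArrow} (hW : IsOpen W) (hne : W.Nonempty) :
    ∃ a b, 0 ≤ a ∧ a < b ∧ b ≤ 1 ∧ cell a b ⊆ W := by
  obtain ⟨p, hp⟩ := hne
  rcases mem_sides p with h | h
  · obtain ⟨a, h0, h1, h2⟩ := exists_cell_subset_of_left h.2 (hW.mem_nhds hp)
    exact ⟨a, p.fst, h0, h1, h.1.2, h2⟩
  · obtain ⟨b, h0, h1, h2⟩ := exists_cell_subset_of_right h.2 (hW.mem_nhds hp)
    exact ⟨p.fst, b, h.1.1, h1, h0, h2⟩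

/-- Every point of `𝔸` is isolated from one of its two sides. -/
theorem isOpen_Iic_or_isOpen_Ici (p : DoubleArrow) : IsOpen (Iic p) ∨ IsOpen (Ici p) := by
  rcases mem_sides p with h | h
  · left
    convert isOpen_lt_left p.fst using 1
    ext q
    rw [mem_Iic, ← not_lt, lt_coords, mem_ofPred_eq]
    rcases mem_sides q with h' | h' <;> rcases lt_trichotomy p.fst q.fst with h1 | h1 | h1 <;>
      first
      | simp [h.2, h'.2, h1, h1.not_gt, h1.ne, h1.ne', -not_or]
      | simp [h.2, h'.2, h1, -not_or]
  · right
    convert isOpen_gt_right p.fst using 1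
    ext q
    rw [mem_Ici, ← not_lt, lt_coords, mem_ofPred_eq]
    rcases mem_sides q with h' | h' <;> rcases lt_trichotomy p.fst q.fst with h1 | h1 | h1 <;>
      first
      | simp [h.2, h'.2, h1, h1.not_gt, h1.ne, h1.ne', -not_or]
      | simp [h.2, h'.2, h1, -not_or]

theorem nonempty_cell {a b : ℝ} (h0 : 0 ≤ a) (h : a < b) (h1 : b ≤ 1) : (cell a b).Nonempty :=
  ⟨_, right_mem_cell ⟨h0, h.trans_le h1⟩ h⟩

end DoubleArrow

namespace DoubleArrow

/-! ### Continuous maps are monotone on small cells -/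

/-- If the values of a continuous `g` at densely many points of `𝔸₀` bound the values of `g` to the
left of these points from above, then `g` is monotone. -/
theorem monotoneOn_cell_of_dense {Y : Type*} [LinearOrder Y] [TopologicalSpace Y] [OrderTopology Y]
    {g : DoubleArrow → Y} (hg : Continuous g) {E : Set ℝ} {a b : ℝ}
    (hE : Ioo a b ⊆ closure E)
    (hle : ∀ x ∈ E, ∀ hx : x ∈ Ioc (0 : ℝ) 1, ∀ z ∈ cell a x, g z ≤ g (left x hx)) :
    MonotoneOn g (cell a b) := by
  intro p hp q hq hpq
  refine le_of_not_gt fun hlt => ?_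
  have hpq' : p < q := lt_of_le_of_ne hpq (by rintro rfl; exact lt_irrefl _ hlt)
  have hopen : IsOpen (cell a b ∩ Ioi p ∩ g ⁻¹' Iio (g p)) :=
    ((isOpen_cell a b).inter isOpen_Ioi).inter (isOpen_Iio.preimage hg)
  obtain ⟨c, d, hc0, hcd, hd1, hsub⟩ := exists_cell_subset hopen ⟨q, ⟨hq, hpq'⟩, hlt⟩
  have hcd' : ∀ y ∈ Ioo c d, y ∈ Ioo a b := by
    intro y hy
    have hz : ∀ z ∈ Ioo c d, z ∈ Icc a b := fun z hz => by
      have hz' : z ∈ Ioc (0 : ℝ) 1 := ⟨hc0.trans_lt hz.1, hz.2.le.trans hd1⟩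
      exact fst_mem_of_mem_cell (hsub (mem_cell_of_fst_mem (p := left z hz') hz)).1.1
    have e1 := (hz ((c + y) / 2) ⟨by linarith [hy.1], by linarith [hy.1, hy.2]⟩).1
    have e2 := (hz ((y + d) / 2) ⟨by linarith [hy.1, hy.2], by linarith [hy.2]⟩).2
    constructor <;> linarith [hy.1, hy.2]
  obtain ⟨x, hx, hxE⟩ := mem_closure_iff.1
    (hE (hcd' ((c + d) / 2) ⟨by linarith, by linarith⟩)) (Ioo c d) isOpen_Ioo
    ⟨by linarith, by linarith⟩
  have hx01 : x ∈ Ioc (0 : ℝ) 1 := ⟨hc0.trans_lt hx.1, hx.2.le.trans hd1⟩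
  obtain ⟨⟨-, hxp⟩, hxg⟩ := hsub (mem_cell_of_fst_mem (p := left x hx01) hx)
  refine absurd (hle x hxE hx01 p ⟨hp.1, ?_⟩) (not_le.2 hxg)
  rcases lt_coords.1 hxp with h | h
  · exact Or.inl h
  · exact Or.inr ⟨h.1, h.2.1⟩

/-- For each point of `𝔸₀`, `g` stays on one side of the value at that point on some cell that ends
there and starts at a rational. By Baire's theorem one side and one rational serve a set of points
that is dense in an interval. -/
theorem exists_monotoneOn_or_antitoneOn {g : DoubleArrow → DoubleArrow} (hg : Continuous g)
    {W : Set DoubleArrow} (hW : IsOpen W) (hne : W.Nonempty) :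
    ∃ V ⊆ W, IsOpen V ∧ V.Nonempty ∧ (MonotoneOn g V ∨ AntitoneOn g V) := by
  obtain ⟨a₀, b₀, ha₀, hab₀, hb₀, hsub⟩ := exists_cell_subset hW hne
  -- `F q` and `G q` collect the points where the value bounds `g` from above, resp. from below.
  let F : ℚ → Set ℝ := fun q =>
    {x | (q : ℝ) < x ∧ ∀ hx : x ∈ Ioc (0 : ℝ) 1, ∀ z ∈ cell q x, g z ≤ g (left x hx)}
  let G : ℚ → Set ℝ := fun q =>
    {x | (q : ℝ) < x ∧ ∀ hx : x ∈ Ioc (0 : ℝ) 1, ∀ z ∈ cell q x, g (left x hx) ≤ g z}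
  have hcov : ∀ x, ∃ q, x ∈ F q ∨ x ∈ G q := by
    intro x
    by_cases hx : x ∈ Ioc (0 : ℝ) 1
    swap
    · obtain ⟨q, hq⟩ := exists_rat_lt x
      exact ⟨q, Or.inl ⟨hq, fun h => absurd h hx⟩⟩
    rcases isOpen_Iic_or_isOpen_Ici (g (left x hx)) with ho | ho
    · obtain ⟨a, -, hax, ha⟩ := exists_cell_subset_of_left (p := left x hx) rfl
        ((ho.preimage hg).mem_nhds (self_mem_Iic (a := g (left x hx))))
      obtain ⟨q, hq, hqx⟩ := exists_rat_btwn hax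
      exact ⟨q, Or.inl ⟨hqx, fun _ z hz => ha (cell_mono hq.le le_rfl hz)⟩⟩
    · obtain ⟨a, -, hax, ha⟩ := exists_cell_subset_of_left (p := left x hx) rfl
        ((ho.preimage hg).mem_nhds (self_mem_Ici (a := g (left x hx))))
      obtain ⟨q, hq, hqx⟩ := exists_rat_btwn hax
      exact ⟨q, Or.inr ⟨hqx, fun _ z hz => ha (cell_mono hq.le le_rfl hz)⟩⟩
  have hdense := dense_iUnion_interior_of_closed
    (f := fun i : ℚ ⊕ ℚ => closure (Sum.elim F G i)) (fun _ => isClosed_closure) (by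
      refine eq_univ_of_forall fun x => mem_iUnion.2 ?_
      obtain ⟨q, hq | hq⟩ := hcov x
      exacts [⟨Sum.inl q, subset_closure hq⟩, ⟨Sum.inr q, subset_closure hq⟩])
  obtain ⟨y, hy, hy'⟩ := hdense.inter_open_nonempty (Ioo a₀ b₀) isOpen_Ioo (nonempty_Ioo.2 hab₀)
  obtain ⟨i, hi⟩ := mem_iUnion.1 hy'
  obtain ⟨a, b, hyab, hab⟩ := mem_nhds_iff_exists_Ioo_subset.1
    ((isOpen_Ioo.inter isOpen_interior).mem_nhds ⟨hy, hi⟩)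
  have haa : a₀ ≤ a := ((Ioo_subset_Ioo_iff (hyab.1.trans hyab.2)).1 fun z hz => (hab hz).1).1
  have hbb : b ≤ b₀ := ((Ioo_subset_Ioo_iff (hyab.1.trans hyab.2)).1 fun z hz => (hab hz).1).2
  refine ⟨cell a b, (cell_mono haa hbb).trans hsub, isOpen_cell a b,
    nonempty_cell (ha₀.trans haa) (hyab.1.trans hyab.2) (hbb.trans hb₀), ?_⟩
  -- Density in `Ioo a b` of a set bounded below by `q` forces `q ≤ a`, so cells from `a`
  -- lie in cells from `q`.
  have key : ∀ (q : ℚ) (T : Set ℝ), (∀ x ∈ T, (q : ℝ) < x) → Ioo a b ⊆ closure T → (q : ℝ) ≤ a := by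
    intro q T hT hcl
    have h1 : Ioo a b ⊆ Ici (q : ℝ) :=
      hcl.trans (closure_minimal (fun x hx => (hT x hx).le) isClosed_Ici)
    refine le_of_forall_gt_imp_ge_of_dense fun z hz => ?_
    have h2 : min z y ∈ Ioo a b := ⟨lt_min hz hyab.1, (min_le_right _ _).trans_lt hyab.2⟩
    exact (mem_Ici.1 (h1 h2)).trans (min_le_left _ _)
  have hcl : Ioo a b ⊆ closure (Sum.elim F G i) := fun z hz => interior_subset (hab hz).2
  rcases i with q | q
  · have hq := key q (F q) (fun x hx => hx.1) hcl
    exact Or.inl (monotoneOn_cell_of_dense hg hcl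
      fun x hx hx' z hz => hx.2 hx' z (cell_mono hq le_rfl hz))
  · have hq := key q (G q) (fun x hx => hx.1) hcl
    have := monotoneOn_cell_of_dense (g := OrderDual.toDual ∘ g) (continuous_toDual.comp hg) hcl
      fun x hx hx' z hz => hx.2 hx' z (cell_mono hq le_rfl hz)
    exact Or.inr fun p hp r hr hpr => this hp hr hpr

/-! ### Full fibres and the invariant open set -/

/-- The points of `D` whose twin, the other point of `𝔸` with the same projection, is in `D`. Twins
are the pairs of points of `𝔸` with nothing strictly between them. -/
def twinPart (D : Set DoubleArrow) : Set DoubleArrow :=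
  {p | p ∈ D ∧ ∃ q ∈ D, p ⋖ q ∨ q ⋖ p}

theorem fst_eq_of_covBy {p q : DoubleArrow} (h : p ⋖ q) :
    p.fst = q.fst ∧ p.snd = 0 ∧ q.snd = 1 := by
  rcases lt_coords.1 h.1 with h' | h'
  · obtain ⟨x, hx⟩ := exists_between h'
    have hx0 : x ∈ Ioc (0 : ℝ) 1 := by
      rcases mem_sides p with hp | hp <;> rcases mem_sides q with hq | hq <;>
        constructor <;> linarith [hp.1.1, hp.1.2, hq.1.1, hq.1.2, hx.1, hx.2]
    exact (h.2 (c := left x hx0) (lt_coords.2 (Or.inl hx.1)) (lt_coords.2 (Or.inl hx.2))).elim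
  · exact h'

theorem covBy_left_right {x : ℝ} (h : x ∈ Ioo (0 : ℝ) 1) :
    left x (Ioo_subset_Ioc_self h) ⋖ right x (Ioo_subset_Ico_self h) := by
  refine ⟨lt_coords.2 (Or.inr ⟨rfl, rfl, rfl⟩), fun c h1 h2 => ?_⟩
  rcases lt_coords.1 h1 with h1 | h1 <;> rcases lt_coords.1 h2 with h2 | h2 <;>
    simp_all [lt_asymm]

/-- The largest open set in which the points of the full fibres of `D` are dense. -/
def twinRegion (D : Set DoubleArrow) : Set DoubleArrow := interior (closure (twinPart D))

/-- A homeomorphism may split or create twins, but it preserves twins in some open part of every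
open set. -/
theorem image_twinRegion_subset (h : DoubleArrow ≃ₜ DoubleArrow) (D : Set DoubleArrow) :
    h '' twinRegion D ⊆ twinRegion (h '' D) := by
  refine interior_maximal ?_ (h.isOpenMap _ isOpen_interior)
  rintro _ ⟨p, hp, rfl⟩
  refine mem_closure_iff.2 fun U hU hpU => ?_
  obtain ⟨V, hVW, hV, hVne, hmon⟩ := exists_monotoneOn_or_antitoneOn h.continuous
    ((hU.preimage h.continuous).inter isOpen_interior) ⟨p, hpU, hp⟩
  obtain ⟨c, d, h0, hcd, h1, hcell⟩ := exists_cell_subset (h.isOpenMap V hV) (hVne.image h)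
  -- On `h ⁻¹' cell c d` the map is an order isomorphism or an anti-isomorphism onto a convex set.
  have hV' : h ⁻¹' cell c d ⊆ V := by
    intro z hz
    obtain ⟨w, hw, hwz⟩ := hcell hz
    rwa [← h.injective hwz]
  have hne : (h ⁻¹' cell c d).Nonempty := (nonempty_cell h0 hcd h1).preimage h.surjective
  obtain ⟨a, b, ha, hab, hb1, hsub⟩ :=
    exists_cell_subset ((isOpen_cell c d).preimage h.continuous) hne
  have hne' : (cell ((2 * a + b) / 3) ((a + 2 * b) / 3)).Nonempty :=
    nonempty_cell (by linarith) (by linarith) (by linarith)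
  -- The middle third keeps twins of points inside `cell a b`.
  obtain ⟨z₀, hz₀⟩ := hne'
  have hz₀V := hVW (hV' (hsub (cell_mono (by linarith) (by linarith) hz₀)))
  obtain ⟨u, hu, huD, v, hvD, huv⟩ := mem_closure_iff.1 (interior_subset hz₀V.2) _
    (isOpen_cell ((2 * a + b) / 3) ((a + 2 * b) / 3)) hz₀
  have hu' := fst_mem_of_mem_cell hu
  have hfst : v.fst = u.fst := by
    rcases huv with h' | h'
    exacts [(fst_eq_of_covBy h').1.symm, (fst_eq_of_covBy h').1]
  have huc : h u ∈ cell c d :=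
    hsub (mem_cell_of_fst_mem ⟨by linarith [hu'.1], by linarith [hu'.2]⟩)
  have hvc : h v ∈ cell c d :=
    hsub (mem_cell_of_fst_mem ⟨by linarith [hu'.1], by linarith [hu'.2]⟩)
  have hcov : ∀ r s, h r ∈ cell c d → h s ∈ cell c d → r ⋖ s → h r ⋖ h s ∨ h s ⋖ h r := by
    intro r s hr hs hrs
    rcases hmon with hm | hm
    · left
      have hm' : StrictMonoOn h V := fun x hx y hy hxy =>
        lt_of_le_of_ne (hm hx hy hxy.le) (h.injective.ne hxy.ne)
      refine ⟨hm' (hV' hr) (hV' hs) hrs.1, fun z hz1 hz2 => ?_⟩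
      obtain ⟨w, rfl⟩ := h.surjective z
      have hw : h w ∈ cell c d := (ordConnected_cell c d).out hr hs ⟨hz1.le, hz2.le⟩
      exact hrs.2 ((hm'.lt_iff_lt (hV' hr) (hV' hw)).1 hz1)
        ((hm'.lt_iff_lt (hV' hw) (hV' hs)).1 hz2)
    · right
      have hm' : StrictAntiOn h V := fun x hx y hy hxy =>
        lt_of_le_of_ne (hm hx hy hxy.le) (h.injective.ne hxy.ne')
      refine ⟨hm' (hV' hr) (hV' hs) hrs.1, fun z hz1 hz2 => ?_⟩
      obtain ⟨w, rfl⟩ := h.surjective z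
      have hw : h w ∈ cell c d := (ordConnected_cell c d).out hs hr ⟨hz1.le, hz2.le⟩
      exact hrs.2 ((hm'.lt_iff_gt (hV' hw) (hV' hr)).1 hz2)
        ((hm'.lt_iff_gt (hV' hs) (hV' hw)).1 hz1)
  refine ⟨h u, (hVW (hV' huc)).1, mem_image_of_mem h huD, h v, mem_image_of_mem h hvD, ?_⟩
  rcases huv with h' | h'
  · exact hcov u v huc hvc h'
  · exact (hcov v u hvc huc h').symm

theorem image_twinRegion (h : DoubleArrow ≃ₜ DoubleArrow) (D : Set DoubleArrow) :
    h '' twinRegion D = twinRegion (h '' D) := by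
  refine (image_twinRegion_subset h D).antisymm ?_
  have := image_mono (f := h) (image_twinRegion_subset h.symm (h '' D))
  simpa [image_image] using this

end DoubleArrow

/-! ### A continuous copy of an ordinal in the unit interval -/

section Ordinal

open Order Ordinal

/-- The sum of the weights `2⁻¹, 2⁻², …` of the indices `n` with `e n < α`. When `e` enumerates the
ordinals below `θ`, this embeds `Iic θ` in the unit interval as a closed set. -/
noncomputable def ordinalEmbedding (e : ℕ → Ordinal.{0}) (α : Ordinal.{0}) : ℝ :=
  ∑' n, {n | e n < α}.indicator (fun n => (1 / 2 : ℝ) ^ (n + 1)) n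

theorem summable_half_pow_succ : Summable fun n : ℕ => (1 / 2 : ℝ) ^ (n + 1) :=
  (summable_nat_add_iff 1).2 summable_geometric_two

theorem ordinalEmbedding_zero (e : ℕ → Ordinal.{0}) : ordinalEmbedding e 0 = 0 := by
  simp [ordinalEmbedding]

theorem ordinalEmbedding_top {e : ℕ → Ordinal.{0}} {θ : Ordinal.{0}} (he : ∀ n, e n < θ) :
    ordinalEmbedding e θ = 1 := by
  have : {n | e n < θ} = Set.univ := eq_univ_of_forall he
  rw [ordinalEmbedding, this]
  simp only [Set.indicator_univ, pow_succ]
  rw [tsum_mul_right, tsum_geometric_two]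
  norm_num

theorem ordinalEmbedding_strictMonoOn {e : ℕ → Ordinal.{0}} {θ : Ordinal.{0}}
    (he : range e = Iio θ) : StrictMonoOn (ordinalEmbedding e) (Iic θ) := by
  intro α hα β hβ h
  obtain ⟨n, hn⟩ : α ∈ range e := he ▸ mem_Iio.2 (h.trans_le hβ)
  have hsum := fun γ : Ordinal.{0} => summable_half_pow_succ.indicator {n | e n < γ}
  refine (hsum α).tsum_lt_tsum (i := n) (fun m => ?_) ?_ (hsum β)
  · exact indicator_le_indicator_of_subset (fun k (hk : e k < α) => hk.trans h)
      (fun _ => by positivity) m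
  · rw [indicator_of_notMem (by simp [hn]), indicator_of_mem (by simpa [hn] using h)]
    positivity

theorem exists_lt_ordinalEmbedding {e : ℕ → Ordinal.{0}} {l : Ordinal.{0}} (hl : IsSuccLimit l)
    {a : ℝ} (ha : a < ordinalEmbedding e l) : ∃ γ < l, a < ordinalEmbedding e γ := by
  have hsum := fun γ : Ordinal.{0} => summable_half_pow_succ.indicator {n | e n < γ}
  obtain ⟨s, hs⟩ := (((hsum l).hasSum).eventually (lt_mem_nhds ha)).exists
  -- A `γ < l` above the finitely many `e n < l`, `n ∈ s`, already collects their weights.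
  have hγ : ∀ t : Finset ℕ, ∃ γ < l, ∀ n ∈ t, e n < l → e n < γ := by
    intro t
    induction t using Finset.induction_on with
    | empty => exact ⟨0, hl.bot_lt, by simp⟩
    | insert k t _ ih =>
      obtain ⟨γ, hγ, h⟩ := ih
      by_cases hk : e k < l
      · refine ⟨max γ (succ (e k)), max_lt hγ (hl.succ_lt hk), fun m hm hml => ?_⟩
        rcases Finset.mem_insert.1 hm with rfl | hm
        · exact lt_max_of_lt_right (lt_succ _)
        · exact lt_max_of_lt_left (h m hm hml)
      · refine ⟨γ, hγ, fun m hm hml => ?_⟩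
        rcases Finset.mem_insert.1 hm with rfl | hm
        · exact absurd hml hk
        · exact h m hm hml
  obtain ⟨γ, hγl, hγ⟩ := hγ s
  refine ⟨γ, hγl, hs.trans_le ?_⟩
  refine le_trans (Finset.sum_le_sum fun n hn => ?_)
    ((hsum γ).sum_le_tsum s fun n _ => indicator_nonneg (fun _ _ => by positivity) n)
  by_cases h : e n < l
  · rw [indicator_of_mem (by exact h), indicator_of_mem (by exact hγ n hn h)]
  · rw [indicator_of_notMem (by exact h)]
    exact indicator_nonneg (fun _ _ => by positivity) n

theorem exists_enumeration_omega0_opow_omega0 :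
    ∃ e : ℕ → Ordinal.{0}, range e = Iio (ω ^ ω) := by
  have hc : (Iio (ω ^ ω : Ordinal.{0})).Countable := by
    rw [← Cardinal.le_aleph0_iff_set_countable, Cardinal.mk_Iio_ordinal, Cardinal.lift_le_aleph0]
    simpa using card_opow_le ω ω
  have hne : (Iio (ω ^ ω : Ordinal.{0})).Nonempty := ⟨0, opow_pos ω omega0_pos⟩
  obtain ⟨e, he⟩ := hc.exists_eq_range hne
  exact ⟨e, he.symm⟩

/-- The multiples of `b` are cofinal in every multiple of `b * ω`. -/
theorem exists_dvd_between {b l γ : Ordinal.{0}} (hb : b ≠ 0) (h : b * ω ∣ l) (hγ : γ < l) :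
    ∃ μ, b ∣ μ ∧ γ < μ ∧ μ < l := by
  obtain ⟨c, rfl⟩ := h
  have hc : c ≠ 0 := by rintro rfl; simp at hγ
  have hb' : 0 < b := pos_iff_ne_zero.2 hb
  refine ⟨b * succ (γ / b), dvd_mul_right _ _, lt_mul_succ_div γ hb, ?_⟩
  rw [mul_assoc] at hγ ⊢
  have hlim : IsSuccLimit (ω * c) :=
    isSuccLimit_iff.2 ⟨mul_ne_zero omega0_ne_zero hc,
      isSuccPrelimit_iff_omega0_dvd.2 (dvd_mul_right _ _)⟩
  exact (mul_lt_mul_iff_right₀ hb').2 (hlim.succ_lt ((lt_mul_iff_div_lt hb).1 hγ))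

/-- The multiples of `b` are not cofinal in any other positive ordinal. -/
theorem exists_no_dvd_between {b l : Ordinal.{0}} (hb : b ≠ 0) (hl : l ≠ 0) (h : ¬ b * ω ∣ l) :
    ∃ γ < l, ∀ μ, b ∣ μ → γ < μ → l ≤ μ := by
  have hb' : 0 < b := pos_iff_ne_zero.2 hb
  by_cases hd : b ∣ l
  · obtain ⟨q, rfl⟩ := hd
    have hq : ¬ IsSuccLimit q := by
      rw [isSuccLimit_iff, isSuccPrelimit_iff_omega0_dvd]
      rintro ⟨-, hq⟩
      exact h (mul_dvd_mul_left b hq)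
    rcases zero_or_succ_or_isSuccLimit q with rfl | ⟨s, rfl⟩ | hq'
    · simp at hl
    · refine ⟨b * s, (mul_lt_mul_iff_right₀ hb').2 (lt_succ s), ?_⟩
      rintro _ ⟨u, rfl⟩ hu
      exact mul_le_mul_right (succ_le_of_lt ((mul_lt_mul_iff_right₀ hb').1 hu)) b
    · exact absurd hq' hq
  · refine ⟨b * (l / b), lt_of_le_of_ne (mul_div_le l b) fun he => hd ⟨_, he.symm⟩, ?_⟩
    rintro _ ⟨u, rfl⟩ hu
    exact (lt_mul_succ_div l hb).le.trans
      (mul_le_mul_right (succ_le_of_lt ((mul_lt_mul_iff_right₀ hb').1 hu)) b)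

end Ordinal

namespace DoubleArrow

open Order Ordinal

/-! ### The dense set that codes a set of natural numbers -/

/-- The midpoint of the gap between consecutive points of the copy of the ordinals. -/
noncomputable def gapMid (e : ℕ → Ordinal.{0}) (α : Ordinal.{0}) : ℝ :=
  (ordinalEmbedding e α + ordinalEmbedding e (succ α)) / 2

/-- The union of the lower halves of the gaps. A gap is the cell between the images of an ordinal
`α < ω ^ ω` and its successor. -/
def lowerHalves (e : ℕ → Ordinal.{0}) : Set DoubleArrow :=
  ⋃ α ∈ Iio (ω ^ ω : Ordinal.{0}), cell (ordinalEmbedding e α) (gapMid e α)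

/-- The union of the upper halves of the gaps. -/
def upperHalves (e : ℕ → Ordinal.{0}) : Set DoubleArrow :=
  ⋃ α ∈ Iio (ω ^ ω : Ordinal.{0}), cell (gapMid e α) (ordinalEmbedding e (succ α))

/-- The points of `𝔸₀` over the images of the positive ordinals up to `ω ^ ω` that are multiples
of `ω ^ (n + 1)`. For `n = 0` these are the limit ordinals. -/
def multiplesSet (e : ℕ → Ordinal.{0}) (n : ℕ) : Set DoubleArrow :=
  {p | p.snd = 0 ∧ ∃ l ≤ (ω ^ ω : Ordinal.{0}), l ≠ 0 ∧ ω ^ (n + 1) ∣ l ∧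
    p.fst = ordinalEmbedding e l}

variable {e : ℕ → Ordinal.{0}}

theorem cell_disjoint {a b c d : ℝ} (h : b ≤ c) {p : DoubleArrow} (hp : p ∈ cell a b)
    (hq : p ∈ cell c d) : False := by
  rcases hp.2 with h1 | h1 <;> rcases hq.1 with h2 | h2
  · linarith
  · linarith [h2.1]
  · linarith [h1.1]
  · simp [h1.2] at h2

theorem ordinalEmbedding_succ_lt (he : range e = Iio (ω ^ ω)) {α : Ordinal.{0}} (hα : α < ω ^ ω) :
    ordinalEmbedding e α < ordinalEmbedding e (succ α) :=
  ordinalEmbedding_strictMonoOn he hα.le (mem_Iic.2 (succ_le_of_lt hα)) (lt_succ α)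

theorem gapMid_mem_gap (he : range e = Iio (ω ^ ω)) {α : Ordinal.{0}} (hα : α < ω ^ ω) :
    ordinalEmbedding e α < gapMid e α ∧ gapMid e α < ordinalEmbedding e (succ α) := by
  have := ordinalEmbedding_succ_lt he hα
  unfold gapMid
  constructor <;> linarith

theorem ordinalEmbedding_mem_Icc (he : range e = Iio (ω ^ ω)) {α : Ordinal.{0}} (hα : α ≤ ω ^ ω) :
    ordinalEmbedding e α ∈ Icc (0 : ℝ) 1 := by
  have hm := (ordinalEmbedding_strictMonoOn he).monotoneOn
  have he' : ∀ n, e n < ω ^ ω := fun n => by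
    have : e n ∈ range e := mem_range_self n
    rwa [he] at this
  constructor
  · rw [← ordinalEmbedding_zero e]
    exact hm (mem_Iic.2 (zero_le)) hα (zero_le)
  · rw [← ordinalEmbedding_top he']
    exact hm hα (mem_Iic.2 le_rfl) hα

theorem ordinalEmbedding_mem_Ioc (he : range e = Iio (ω ^ ω)) {α : Ordinal.{0}} (hα : α ≤ ω ^ ω)
    (h0 : α ≠ 0) : ordinalEmbedding e α ∈ Ioc (0 : ℝ) 1 := by
  refine ⟨?_, (ordinalEmbedding_mem_Icc he hα).2⟩
  rw [← ordinalEmbedding_zero e]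
  exact ordinalEmbedding_strictMonoOn he (mem_Iic.2 zero_le) hα (pos_iff_ne_zero.2 h0)

theorem mem_gap_of_mem_lowerHalves (he : range e = Iio (ω ^ ω)) {p : DoubleArrow}
    (hp : p ∈ lowerHalves e) : ∃ α < ω ^ ω, p ∈ cell (ordinalEmbedding e α) (gapMid e α) ∧
      p ∈ cell (ordinalEmbedding e α) (ordinalEmbedding e (succ α)) := by
  simp only [lowerHalves, mem_iUnion, mem_Iio] at hp
  obtain ⟨α, hα, hp⟩ := hp
  exact ⟨α, hα, hp, cell_mono le_rfl (gapMid_mem_gap he hα).2.le hp⟩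

theorem mem_gap_of_mem_upperHalves (he : range e = Iio (ω ^ ω)) {p : DoubleArrow}
    (hp : p ∈ upperHalves e) : ∃ α < ω ^ ω, p ∈ cell (gapMid e α) (ordinalEmbedding e (succ α)) ∧
      p ∈ cell (ordinalEmbedding e α) (ordinalEmbedding e (succ α)) := by
  simp only [upperHalves, mem_iUnion, mem_Iio] at hp
  obtain ⟨α, hα, hp⟩ := hp
  exact ⟨α, hα, hp, cell_mono (gapMid_mem_gap he hα).1.le le_rfl hp⟩

theorem gap_index_unique (he : range e = Iio (ω ^ ω)) {p : DoubleArrow} {α β : Ordinal.{0}}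
    (hα : α < ω ^ ω) (hβ : β < ω ^ ω)
    (hpα : p ∈ cell (ordinalEmbedding e α) (ordinalEmbedding e (succ α)))
    (hpβ : p ∈ cell (ordinalEmbedding e β) (ordinalEmbedding e (succ β))) : α = β := by
  have hm := (ordinalEmbedding_strictMonoOn he).monotoneOn
  rcases lt_trichotomy α β with h | h | h
  · exact (cell_disjoint (hm (mem_Iic.2 (succ_le_of_lt hα)) hβ.le (succ_le_of_lt h)) hpα hpβ).elim
  · exact h
  · exact (cell_disjoint (hm (mem_Iic.2 (succ_le_of_lt hβ)) hα.le (succ_le_of_lt h)) hpβ hpα).elim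

theorem disjoint_lowerHalves_upperHalves (he : range e = Iio (ω ^ ω)) :
    Disjoint (lowerHalves e) (upperHalves e) := by
  refine disjoint_left.2 fun p hl hu => ?_
  obtain ⟨α, hα, h1, h2⟩ := mem_gap_of_mem_lowerHalves he hl
  obtain ⟨β, hβ, h3, h4⟩ := mem_gap_of_mem_upperHalves he hu
  obtain rfl := gap_index_unique he hα hβ h2 h4
  exact cell_disjoint le_rfl h1 h3

/-- Points over limit ordinals lie in no gap: a point of `𝔸₀` in a gap that is over an ordinal is
over a successor. -/
theorem notMem_gap_of_mem_multiplesSet (he : range e = Iio (ω ^ ω)) {p : DoubleArrow} {n : ℕ}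
    (hp : p ∈ multiplesSet e n) {α : Ordinal.{0}} (hα : α < ω ^ ω) :
    p ∉ cell (ordinalEmbedding e α) (ordinalEmbedding e (succ α)) := by
  intro h
  obtain ⟨hs, l, hl, hl0, hd, hf⟩ := hp
  have hm := ordinalEmbedding_strictMonoOn he
  have h1 : α < l := by
    rw [← hm.lt_iff_lt hα.le hl, ← hf]
    rcases h.1 with h | h
    · exact h
    · simp [hs] at h
  have h2 : l ≤ succ α := by
    rw [← hm.le_iff_le hl (mem_Iic.2 (succ_le_of_lt hα)), ← hf]
    exact (fst_mem_of_mem_cell h).2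
  obtain rfl := h2.antisymm (succ_le_of_lt h1)
  have := isSuccPrelimit_iff_omega0_dvd.2 ((dvd_pow_self ω n.succ_ne_zero).trans hd)
  exact not_isSuccPrelimit_succ α this

theorem mem_halves_or_mem_multiplesSet (he : range e = Iio (ω ^ ω)) (p : DoubleArrow) :
    p ∈ lowerHalves e ∨ p ∈ upperHalves e ∨ p ∈ multiplesSet e 0 := by
  have he' : ∀ n, e n < ω ^ ω := fun n => by
    have : e n ∈ range e := mem_range_self n
    rwa [he] at this
  -- The least ordinal whose point in `𝔸₀` is not below `p`.
  let s : Set Ordinal.{0} :=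
    {α | p.fst < ordinalEmbedding e α ∨ p.fst = ordinalEmbedding e α ∧ p.snd = 0}
  have hθ : ω ^ ω ∈ s := by
    change p.fst < ordinalEmbedding e (ω ^ ω) ∨ p.fst = ordinalEmbedding e (ω ^ ω) ∧ p.snd = 0
    rw [ordinalEmbedding_top he']
    rcases mem_sides p with h | h
    · rcases h.1.2.lt_or_eq with h' | h'
      exacts [Or.inl h', Or.inr ⟨h', h.2⟩]
    · exact Or.inl h.1.2
  obtain ⟨l, hl, hmin⟩ := WellFounded.has_min (wellFounded_lt (α := Ordinal.{0})) s ⟨_, hθ⟩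
  have hle : l ≤ ω ^ ω := not_lt.1 (hmin _ hθ)
  have hgt : ∀ α < l, ordinalEmbedding e α < p.fst ∨
      ordinalEmbedding e α = p.fst ∧ p.snd = 1 := by
    intro α hα
    have h1 : ¬(p.fst < ordinalEmbedding e α ∨ p.fst = ordinalEmbedding e α ∧ p.snd = 0) :=
      fun h => hmin α h hα
    rw [not_or, not_lt, not_and] at h1
    rcases h1.1.lt_or_eq with h2 | h2
    · exact Or.inl h2
    · refine Or.inr ⟨h2, ?_⟩
      rcases mem_sides p with h | h
      exacts [absurd h.2 (h1.2 h2.symm), h.2]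
  rcases zero_or_succ_or_isSuccLimit l with rfl | ⟨α, rfl⟩ | hlim
  · exfalso
    have hl' : p.fst < ordinalEmbedding e 0 ∨ p.fst = ordinalEmbedding e 0 ∧ p.snd = 0 := hl
    rw [ordinalEmbedding_zero] at hl'
    rcases mem_sides p with h | h
    · rcases hl' with h' | h' <;> linarith [h.1.1]
    · rcases hl' with h' | h'
      · linarith [h.1.1]
      · simp [h.2] at h'
  · have hα : α < ω ^ ω := (lt_succ α).trans_le hle
    have h1 := hgt α (lt_succ α)
    rcases lt_trichotomy p.fst (gapMid e α) with h | h | h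
    · exact Or.inl (mem_biUnion (mem_Iio.2 hα) ⟨h1, Or.inl h⟩)
    · rcases mem_sides p with hs | hs
      · exact Or.inl (mem_biUnion (mem_Iio.2 hα) ⟨h1, Or.inr ⟨h, hs.2⟩⟩)
      · exact Or.inr (Or.inl (mem_biUnion (mem_Iio.2 hα) ⟨Or.inr ⟨h.symm, hs.2⟩, hl⟩))
    · exact Or.inr (Or.inl (mem_biUnion (mem_Iio.2 hα) ⟨Or.inl h, hl⟩))
  · refine Or.inr (Or.inr ?_)
    have hge : ordinalEmbedding e l ≤ p.fst := by
      refine le_of_not_gt fun h => ?_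
      obtain ⟨γ, hγ, h'⟩ := exists_lt_ordinalEmbedding hlim h
      rcases hgt γ hγ with h'' | h'' <;> linarith
    have hl' : p.fst < ordinalEmbedding e l ∨ p.fst = ordinalEmbedding e l ∧ p.snd = 0 := hl
    rcases hl' with h | h
    · exact absurd hge (not_le.2 h)
    · exact ⟨h.2, l, hle, hlim.ne_bot,
        by simpa using isSuccPrelimit_iff_omega0_dvd.1 hlim.isSuccPrelimit, h.1⟩

/-- Whole gaps accumulate at every point over a limit ordinal. -/
theorem exists_gap_subset (he : range e = Iio (ω ^ ω)) {p : DoubleArrow}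
    (hp : p ∈ multiplesSet e 0) {U : Set DoubleArrow} (hU : U ∈ 𝓝 p) :
    ∃ α < ω ^ ω, cell (ordinalEmbedding e α) (ordinalEmbedding e (succ α)) ⊆ U := by
  obtain ⟨hs, l, hl, hl0, hd, hf⟩ := hp
  obtain ⟨a, -, hap, haU⟩ := exists_cell_subset_of_left hs hU
  have hlim : IsSuccLimit l := isSuccLimit_iff.2
    ⟨hl0, isSuccPrelimit_iff_omega0_dvd.2 (by simpa using hd)⟩
  rw [hf] at hap haU
  obtain ⟨γ, hγ, hγ'⟩ := exists_lt_ordinalEmbedding hlim hap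
  refine ⟨γ, hγ.trans_le hl, (cell_mono hγ'.le ?_).trans haU⟩
  exact (ordinalEmbedding_strictMonoOn he).monotoneOn
    (mem_Iic.2 (succ_le_of_lt (hγ.trans_le hl))) hl (succ_le_of_lt hγ)

theorem isOpen_lowerHalves : IsOpen (lowerHalves e) :=
  isOpen_biUnion fun _ _ => isOpen_cell _ _

theorem isOpen_upperHalves : IsOpen (upperHalves e) :=
  isOpen_biUnion fun _ _ => isOpen_cell _ _

theorem multiplesSet_zero_subset_closure_lowerHalves (he : range e = Iio (ω ^ ω)) :
    multiplesSet e 0 ⊆ closure (lowerHalves e) := by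
  refine fun p hp => mem_closure_iff_nhds.2 fun U hU => ?_
  obtain ⟨α, hα, hsub⟩ := exists_gap_subset he hp hU
  have hg := gapMid_mem_gap he hα
  obtain ⟨z, hz⟩ := nonempty_cell (ordinalEmbedding_mem_Icc he hα.le).1 hg.1
    (hg.2.le.trans (ordinalEmbedding_mem_Icc he (succ_le_of_lt hα)).2)
  exact ⟨z, hsub (cell_mono le_rfl hg.2.le hz), mem_biUnion (mem_Iio.2 hα) hz⟩

theorem multiplesSet_zero_subset_closure_upperHalves (he : range e = Iio (ω ^ ω)) :
    multiplesSet e 0 ⊆ closure (upperHalves e) := by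
  refine fun p hp => mem_closure_iff_nhds.2 fun U hU => ?_
  obtain ⟨α, hα, hsub⟩ := exists_gap_subset he hp hU
  have hg := gapMid_mem_gap he hα
  obtain ⟨z, hz⟩ := nonempty_cell ((ordinalEmbedding_mem_Icc he hα.le).1.trans hg.1.le) hg.2
    (ordinalEmbedding_mem_Icc he (succ_le_of_lt hα)).2
  exact ⟨z, hsub (cell_mono hg.1.le le_rfl hz), mem_biUnion (mem_Iio.2 hα) hz⟩

theorem multiplesSet_antitone : Antitone (multiplesSet e) := by
  rintro m n hmn p ⟨hs, l, hl, hl0, hd, hf⟩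
  exact ⟨hs, l, hl, hl0, (pow_dvd_pow ω (by omega)).trans hd, hf⟩

/-- Derivation raises the exponent of `ω` by one, because a positive ordinal is a limit of multiples
of `b` exactly when it is a multiple of `b * ω`. -/
theorem derivedSet_multiplesSet (he : range e = Iio (ω ^ ω)) (n : ℕ) :
    derivedSet (multiplesSet e n) = multiplesSet e (n + 1) := by
  have hm := ordinalEmbedding_strictMonoOn he
  have hω : (ω : Ordinal.{0}) ^ (n + 1) ≠ 0 := pow_ne_zero _ omega0_ne_zero
  ext p
  rw [mem_derivedSet, accPt_iff_nhds]
  constructor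
  · intro hp
    have hp0 : p ∈ multiplesSet e 0 := by
      rcases mem_halves_or_mem_multiplesSet he p with h | h | h
      · obtain ⟨y, ⟨hy, hy'⟩, -⟩ := hp _ (isOpen_lowerHalves.mem_nhds h)
        obtain ⟨α, hα, -, hc⟩ := mem_gap_of_mem_lowerHalves he hy
        exact absurd hc (notMem_gap_of_mem_multiplesSet he hy' hα)
      · obtain ⟨y, ⟨hy, hy'⟩, -⟩ := hp _ (isOpen_upperHalves.mem_nhds h)
        obtain ⟨α, hα, -, hc⟩ := mem_gap_of_mem_upperHalves he hy
        exact absurd hc (notMem_gap_of_mem_multiplesSet he hy' hα)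
      · exact h
    obtain ⟨hs, l, hl, hl0, -, hf⟩ := hp0
    refine ⟨hs, l, hl, hl0, by_contra fun hd => ?_, hf⟩
    rw [pow_succ] at hd
    obtain ⟨γ, hγ, hno⟩ := exists_no_dvd_between hω hl0 hd
    have hmem : p ∈ cell (ordinalEmbedding e γ) (ordinalEmbedding e l) :=
      ⟨Or.inl (hf ▸ hm (hγ.trans_le hl).le hl hγ), Or.inr ⟨hf, hs⟩⟩
    obtain ⟨y, ⟨hy, hy'⟩, hne⟩ := hp _ ((isOpen_cell _ _).mem_nhds hmem)
    obtain ⟨hys, μ, hμ, -, hμd, hyf⟩ := hy'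
    have h1 : γ < μ := by
      rw [← hm.lt_iff_lt (hγ.trans_le hl).le hμ, ← hyf]
      rcases hy.1 with h | h
      · exact h
      · simp [hys] at h
    have h2 : μ ≤ l := by
      rw [← hm.le_iff_le hμ hl, ← hyf]
      exact (fst_mem_of_mem_cell hy).2
    obtain rfl := h2.antisymm (hno μ hμd h1)
    exact hne (ext_coords (hyf.trans hf.symm) (hys.trans hs.symm))
  · rintro ⟨hs, l, hl, hl0, hd, hf⟩ U hU
    obtain ⟨a, -, hap, haU⟩ := exists_cell_subset_of_left hs hU
    have hlim : IsSuccLimit l := isSuccLimit_iff.2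
      ⟨hl0, isSuccPrelimit_iff_omega0_dvd.2 ((dvd_pow_self ω (n + 1).succ_ne_zero).trans hd)⟩
    rw [hf] at hap haU
    obtain ⟨γ, hγ, hγ'⟩ := exists_lt_ordinalEmbedding hlim hap
    rw [pow_succ] at hd
    obtain ⟨μ, hμd, hγμ, hμl⟩ := exists_dvd_between hω hd hγ
    have hμ : μ ≤ ω ^ ω := hμl.le.trans hl
    have hμ0 : μ ≠ 0 := ((zero_le).trans_lt hγμ).ne'
    have h1 := hm (hγ.trans_le hl).le hμ hγμ
    have h2 := hm hμ hl hμl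
    refine ⟨left _ (ordinalEmbedding_mem_Ioc he hμ hμ0), ⟨haU (mem_cell_of_fst_mem ?_), ?_⟩, ?_⟩
    · exact ⟨hγ'.trans h1, h2⟩
    · exact ⟨rfl, μ, hμ, hμ0, hμd, rfl⟩
    · intro h
      exact h2.ne ((congrArg fst h).trans hf)

theorem multiplesSet_diff_nonempty (he : range e = Iio (ω ^ ω)) (n : ℕ) :
    (multiplesSet e n \ multiplesSet e (n + 1)).Nonempty := by
  have hle : ∀ k : ℕ, (ω : Ordinal.{0}) ^ k ≤ ω ^ ω := fun k => by
    rw [← opow_natCast]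
    exact opow_le_opow_right omega0_pos (natCast_lt_omega0 k).le
  have h0 : (ω : Ordinal.{0}) ^ (n + 1) ≠ 0 := pow_ne_zero _ omega0_ne_zero
  refine ⟨left _ (ordinalEmbedding_mem_Ioc he (hle (n + 1)) h0),
    ⟨rfl, _, hle _, h0, dvd_rfl, rfl⟩, ?_⟩
  rintro ⟨-, l, hl, hl0, hd, hf⟩
  obtain rfl := (ordinalEmbedding_strictMonoOn he).injOn (hle (n + 1)) hl hf
  refine absurd (le_of_dvd h0 hd) (not_le.2 ?_)
  rw [← opow_natCast, ← opow_natCast]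
  exact (opow_lt_opow_iff_right one_lt_omega0).2 (by exact_mod_cast (n + 1).lt_succ_self)

/-- The set that codes `S`: full fibres over the rationals in the lower halves of the gaps, only
points of `𝔸₁` over the rationals in the upper halves, and, for every `n ∈ S`, the points over
ordinals divisible by `ω ^ (n + 1)` but not by `ω ^ (n + 2)`. -/
def codeSet (e : ℕ → Ordinal.{0}) (S : Set ℕ) : Set DoubleArrow :=
  {p | p ∈ lowerHalves e ∧ p.fst ∈ range ((↑) : ℚ → ℝ)} ∪
    {p | p ∈ upperHalves e ∧ p.snd = 1 ∧ p.fst ∈ range ((↑) : ℚ → ℝ)} ∪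
      ⋃ n ∈ S, multiplesSet e n \ multiplesSet e (n + 1)

theorem countable_preimage_fst {s : Set ℝ} (hs : s.Countable) :
    {p : DoubleArrow | p.fst ∈ s}.Countable := by
  have : (s ×ˢ (Set.univ : Set (Fin 2))).Countable := hs.prod (to_countable _)
  refine (this.preimage_of_injOn (f := fun p : DoubleArrow => (p.fst, p.snd)) ?_).mono ?_
  · intro p _ q _ h
    exact ext_coords (congrArg Prod.fst h) (congrArg Prod.snd h)
  · intro p hp
    exact ⟨hp, mem_univ _⟩

theorem countable_codeSet (he : range e = Iio (ω ^ ω)) (S : Set ℕ) : (codeSet e S).Countable := by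
  have hQ := countable_preimage_fst (countable_range ((↑) : ℚ → ℝ))
  refine ((hQ.mono fun p hp => hp.2).union (hQ.mono fun p hp => hp.2.2)).union ?_
  have hI : (Iic (ω ^ ω : Ordinal.{0})).Countable := by
    rw [← Iio_insert, ← he]
    exact (countable_range e).insert _
  refine (to_countable S).biUnion fun n _ =>
    (countable_preimage_fst (hI.image (ordinalEmbedding e))).mono ?_
  rintro p ⟨⟨-, l, hl, -, -, hf⟩, -⟩
  exact ⟨l, hl, hf.symm⟩

theorem right_rat_mem_codeSet {S : Set ℕ} {x : ℝ} {hx : x ∈ Ico (0 : ℝ) 1}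
    (hq : x ∈ range ((↑) : ℚ → ℝ)) (h : right x hx ∈ lowerHalves e ∪ upperHalves e) :
    right x hx ∈ codeSet e S :=
  h.elim (fun h => Or.inl (Or.inl ⟨h, hq⟩)) fun h => Or.inl (Or.inr ⟨h, rfl, hq⟩)

theorem dense_codeSet (he : range e = Iio (ω ^ ω)) (S : Set ℕ) : Dense (codeSet e S) := by
  refine dense_iff_inter_open.2 fun U hU hne => ?_
  have hne' : (U ∩ (lowerHalves e ∪ upperHalves e)).Nonempty := by
    obtain ⟨p, hp⟩ := hne
    rcases mem_halves_or_mem_multiplesSet he p with h | h | h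
    · exact ⟨p, hp, Or.inl h⟩
    · exact ⟨p, hp, Or.inr h⟩
    · obtain ⟨z, hz, hz'⟩ :=
        mem_closure_iff.1 (multiplesSet_zero_subset_closure_lowerHalves he h) U hU hp
      exact ⟨z, hz, Or.inl hz'⟩
  obtain ⟨a, b, h0, hab, h1, hsub⟩ :=
    exists_cell_subset (hU.inter (isOpen_lowerHalves.union isOpen_upperHalves)) hne'
  obtain ⟨q, hq, hq'⟩ := exists_rat_btwn hab
  have hx : (q : ℝ) ∈ Ico (0 : ℝ) 1 := ⟨h0.trans hq.le, hq'.trans_le h1⟩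
  have hmem := hsub (mem_cell_of_fst_mem (p := right q hx) ⟨hq, hq'⟩)
  exact ⟨right q hx, hmem.1, right_rat_mem_codeSet ⟨q, rfl⟩ hmem.2⟩

theorem notMem_multiplesSet_of_mem_halves (he : range e = Iio (ω ^ ω)) {n : ℕ}
    {p : DoubleArrow} (hp : p ∈ lowerHalves e ∪ upperHalves e) : p ∉ multiplesSet e n := by
  intro h
  rcases hp with hp | hp
  · obtain ⟨α, hα, -, hc⟩ := mem_gap_of_mem_lowerHalves he hp
    exact notMem_gap_of_mem_multiplesSet he h hα hc
  · obtain ⟨α, hα, -, hc⟩ := mem_gap_of_mem_upperHalves he hp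
    exact notMem_gap_of_mem_multiplesSet he h hα hc

/-- In the upper halves a cell contains no full fibre of the code, so the region where full fibres
are dense does not depend on the coded set. -/
theorem twinRegion_codeSet (he : range e = Iio (ω ^ ω)) (S : Set ℕ) :
    twinRegion (codeSet e S) = lowerHalves e := by
  refine Subset.antisymm ?_ (interior_maximal ?_ isOpen_lowerHalves)
  · have hdisj : Disjoint (twinRegion (codeSet e S)) (upperHalves e) := by
      refine disjoint_iff_inter_eq_empty.2 (not_nonempty_iff_eq_empty.1 fun hne => ?_)
      obtain ⟨a, b, h0, hab, h1, hsub⟩ :=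
        exists_cell_subset (isOpen_interior.inter isOpen_upperHalves) hne
      obtain ⟨z, hz⟩ := nonempty_cell (a := (2 * a + b) / 3) (b := (a + 2 * b) / 3)
        (by linarith) (by linarith) (by linarith)
      obtain ⟨u, hu, huD, v, hvD, huv⟩ := mem_closure_iff.1
        (interior_subset (hsub (cell_mono (by linarith) (by linarith) hz)).1) _ (isOpen_cell _ _) hz
      have hu' := fst_mem_of_mem_cell hu
      have key : ∀ w ∈ codeSet e S, w.fst = u.fst → w.snd = 1 := by
        intro w hw hwu
        have hwU := (hsub (mem_cell_of_fst_mem (p := w)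
          ⟨by linarith [hu'.1], by linarith [hu'.2]⟩)).2
        rcases hw with (hw | hw) | hw
        · exact absurd hwU (disjoint_left.1 (disjoint_lowerHalves_upperHalves he) hw.1)
        · exact hw.2.1
        · simp only [mem_iUnion] at hw
          obtain ⟨n, -, hw⟩ := hw
          exact absurd hw.1
            (notMem_multiplesSet_of_mem_halves he (Or.inr hwU))
      rcases huv with h | h
      · have := key u huD rfl
        simp [(fst_eq_of_covBy h).2.1] at this
      · have := key v hvD (fst_eq_of_covBy h).1
        simp [(fst_eq_of_covBy h).2.1] at this
    intro p hp
    rcases mem_halves_or_mem_multiplesSet he p with h | h | h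
    · exact h
    · exact absurd h (disjoint_left.1 hdisj hp)
    · obtain ⟨z, hz, hz'⟩ := mem_closure_iff.1
        (multiplesSet_zero_subset_closure_upperHalves he h) _ isOpen_interior hp
      exact absurd hz' (disjoint_left.1 hdisj hz)
  · refine fun p hp => mem_closure_iff.2 fun U hU hpU => ?_
    obtain ⟨a, b, h0, hab, h1, hsub⟩ :=
      exists_cell_subset (hU.inter isOpen_lowerHalves) ⟨p, hpU, hp⟩
    obtain ⟨q, hq, hq'⟩ := exists_rat_btwn hab
    have hx : (q : ℝ) ∈ Ioo (0 : ℝ) 1 := ⟨h0.trans_lt hq, hq'.trans_le h1⟩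
    have hl := hsub (mem_cell_of_fst_mem (p := left q (Ioo_subset_Ioc_self hx)) ⟨hq, hq'⟩)
    have hr := hsub (mem_cell_of_fst_mem (p := right q (Ioo_subset_Ico_self hx)) ⟨hq, hq'⟩)
    exact ⟨_, hl.1, Or.inl (Or.inl ⟨hl.2, q, rfl⟩), _, Or.inl (Or.inl ⟨hr.2, q, rfl⟩),
      Or.inl (covBy_left_right hx)⟩

theorem frontier_lowerHalves (he : range e = Iio (ω ^ ω)) :
    frontier (lowerHalves e) = multiplesSet e 0 := by
  rw [isOpen_lowerHalves.frontier_eq]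
  ext p
  constructor
  · rintro ⟨h1, h2⟩
    rcases mem_halves_or_mem_multiplesSet he p with h | h | h
    · exact absurd h h2
    · obtain ⟨z, hz, hz'⟩ := mem_closure_iff.1 h1 _ isOpen_upperHalves h
      exact absurd hz (disjoint_left.1 (disjoint_lowerHalves_upperHalves he) hz')
    · exact h
  · exact fun h => ⟨multiplesSet_zero_subset_closure_lowerHalves he h, fun h' =>
      notMem_multiplesSet_of_mem_halves he (Or.inl h') h⟩

/-- The set `S` can be read off from its code and the iterated derived sets of the frontier. -/
theorem mem_iff_codeSet_inter_nonempty (he : range e = Iio (ω ^ ω)) (S : Set ℕ) (n : ℕ) :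
    n ∈ S ↔ (codeSet e S ∩ (multiplesSet e n \ multiplesSet e (n + 1))).Nonempty := by
  constructor
  · intro hn
    obtain ⟨p, hp⟩ := multiplesSet_diff_nonempty he n
    exact ⟨p, Or.inr (mem_biUnion hn hp), hp⟩
  · rintro ⟨p, hp | hp, hpn⟩
    · have : p ∈ lowerHalves e ∪ upperHalves e := hp.imp (fun h => h.1) fun h => h.1
      exact absurd hpn.1 (notMem_multiplesSet_of_mem_halves he this)
    · simp only [mem_iUnion] at hp
      obtain ⟨m, hm, hpm⟩ := hp
      rcases lt_trichotomy m n with h | rfl | h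
      · exact absurd (multiplesSet_antitone (show m + 1 ≤ n from h) hpn.1) hpm.2
      · exact hm
      · exact absurd (multiplesSet_antitone (show n + 1 ≤ m from h) hpm.1) hpn.2

theorem image_derivedSet_homeomorph {X Y : Type*} [TopologicalSpace X] [TopologicalSpace Y]
    (h : X ≃ₜ Y) (A : Set X) : h '' derivedSet A = derivedSet (h '' A) := by
  refine (Continuous.image_derivedSet h.continuous h.injective).antisymm ?_
  have := image_mono (f := h)
    (Continuous.image_derivedSet (A := h '' A) h.symm.continuous h.symm.injective)
  simpa [image_image] using this

/-- A homeomorphism between two codes preserves the common frontier of their regions of full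
fibres, hence also its iterated derived sets. -/
theorem image_multiplesSet (he : range e = Iio (ω ^ ω)) {S S' : Set ℕ}
    (h : DoubleArrow ≃ₜ DoubleArrow) (hh : h '' codeSet e S = codeSet e S') (n : ℕ) :
    h '' multiplesSet e n = multiplesSet e n := by
  induction n with
  | zero =>
    rw [← frontier_lowerHalves he, h.image_frontier]
    nth_rewrite 1 [← twinRegion_codeSet he S]
    rw [image_twinRegion, hh, twinRegion_codeSet he S']
  | succ n ih => rw [← derivedSet_multiplesSet he, image_derivedSet_homeomorph, ih]

theorem eq_of_image_codeSet_eq (he : range e = Iio (ω ^ ω)) {S S' : Set ℕ}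
    (h : DoubleArrow ≃ₜ DoubleArrow) (hh : h '' codeSet e S = codeSet e S') : S = S' := by
  ext n
  have hdiff : h '' (multiplesSet e n \ multiplesSet e (n + 1)) =
      multiplesSet e n \ multiplesSet e (n + 1) := by
    rw [image_sdiff h.injective, image_multiplesSet he h hh, image_multiplesSet he h hh]
  rw [mem_iff_codeSet_inter_nonempty he, mem_iff_codeSet_inter_nonempty he S', ← hh]
  nth_rewrite 2 [← hdiff]
  rw [← image_inter h.injective, image_nonempty]

/-! ### Counting types -/

open Cardinal

theorem continuum_le_of_represents {𝒟 : Set (Set DoubleArrow)}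
    (h𝒟 : RepresentsCountableDenseSubsets 𝒟) : 𝔠 ≤ #𝒟 := by
  obtain ⟨e, he⟩ := exists_enumeration_omega0_opow_omega0
  choose D hD h hh using fun S : Set ℕ =>
    h𝒟.2 (codeSet e S) (countable_codeSet he S) (dense_codeSet he S)
  have hinj : Function.Injective fun S => (⟨D S, hD S⟩ : 𝒟) := by
    intro S S' hSS'
    have hDD : D S = D S' := congrArg Subtype.val hSS'
    refine eq_of_image_codeSet_eq he ((h S).symm.trans (h S')) ?_
    rw [← hh S, ← hh S', hDD, image_image]
    simp
  calc 𝔠 = #(Set ℕ) := by simp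
    _ ≤ #𝒟 := mk_le_of_injective hinj

theorem mk_countable_subsets_le :
    #{D : Set DoubleArrow | D.Countable ∧ Dense D} ≤ 𝔠 := by
  have hA : #DoubleArrow ≤ 𝔠 := by
    have hi : Function.Injective fun p : DoubleArrow => (p.fst, p.snd) := fun p q h =>
      ext_coords (congrArg Prod.fst h) (congrArg Prod.snd h)
    refine (mk_le_of_injective hi).trans ?_
    rw [mk_prod, Cardinal.lift_id, Cardinal.lift_id, mk_real]
    exact mul_le_of_le aleph0_le_continuum le_rfl (mk_le_aleph0.trans aleph0_le_continuum)
  have hsub : {D : Set DoubleArrow | D.Countable ∧ Dense D} ⊆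
      range fun s : ℕ → DoubleArrow => range s := by
    rintro D ⟨hD, hd⟩
    have : Nonempty DoubleArrow := ⟨left 1 ⟨one_pos, le_rfl⟩⟩
    obtain ⟨s, hs⟩ := hD.exists_eq_range hd.nonempty
    exact ⟨s, hs.symm⟩
  calc _ ≤ #(range fun s : ℕ → DoubleArrow => range s) := mk_le_mk_of_subset hsub
    _ ≤ #(ℕ → DoubleArrow) := mk_range_le
    _ = #DoubleArrow ^ ℵ₀ := by simp
    _ ≤ 𝔠 ^ ℵ₀ := power_le_power_right hA
    _ = 𝔠 := continuum_power_aleph0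

end DoubleArrow

theorem mainTheorem5 :
    HasTypesOfCountableDenseSubsets DoubleArrow Cardinal.continuum := by
  have hrep : RepresentsCountableDenseSubsets {D : Set DoubleArrow | D.Countable ∧ Dense D} :=
    ⟨fun D hD => hD, fun E hE hE' => ⟨E, ⟨hE, hE'⟩, Homeomorph.refl _, by simp⟩⟩
  refine ⟨⟨_, hrep, ?_⟩, ?_⟩
  · exact DoubleArrow.mk_countable_subsets_le.antisymm (DoubleArrow.continuum_le_of_represents hrep)
  · rintro c ⟨𝒟, h𝒟, rfl⟩
    exact DoubleArrow.continuum_le_of_represents h𝒟
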